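/- Write $\mathbb{N}_0=\{0,1,2,\dots\}$. Besides ordinary numbers $k\in\mathbb{N}_0$ we use barred symbols $\bar k$, and set $|k|=|\bar k|=k$, $\operatorname{sgn}(k)=1$, $\operatorname{sgn}(\bar k)=-1$; $\{2\}^a$ denotes $2$ repeated $a$ times. For a string $\mathbf{s}=(s_1,\dots,s_m)$ of such (possibly barred) numbers put $$\zeta(\mathbf{s})=\sum_{k_1>\cdots>k_m\ge1}\ \prod_{j=1}^m\frac{\operatorname{sgn}(s_j)^{k_j}}{k_j^{|s_j|}},\qquad \zeta^\star(\mathbf{s})=\sum_{k_1\ge\cdots\ge k_m\ge1}\ \prod_{j=1}^m\frac{\operatorname{sgn}(s_j)^{k_j}}{k_j^{|s_j|}}.$$ For $0<q<1$ let $[k]=1+q+\cdots+q^{k-1}$. For $r\in\mathbb{Z}$ and $k\ge1$ let $Q(r,k)=rk(k-1)/2$ if $r>0$ and $Q(r,k)=rk(k-1)/2-k$ if $r\le0$. For $t_j\in\mathbb{N}_0$ and $r_j\in\mathbb{Z}$ put $$\zeta^\star[\mathbf{s}]=\sum_{k_1\ge\cdots\ge k_m\ge1}\ \prod_{j=1}^m\frac{\operatorname{sgn}(s_j)^{k_j}q^{k_j}}{[k_j]^{|s_j|}},$$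 $$\mathfrak{z}[s_1,\dots,s_m;t_1,\dots,t_m;r_1,\dots,r_m]=\sum_{k_1>\cdots>k_m\ge1}\ \prod_{j=1}^m\frac{\operatorname{sgn}(s_j)^{k_j}q^{t_jk_j+Q(r_j,k_j)}(1+q^{k_j})}{[k_j]^{|s_j|}}.$$ (1) For all integers $a\ge1$ and $b,c,d\ge0$, all the series below converge absolutely and $$\begin{aligned} \zeta^{\star}(\{2\}^{a},1,\{2\}^{b},1,\{2\}^{c},3,\{2\}^{d},1) ={}&2\,\zeta(2a+2b+2c+2d+6)+4\,\zeta(2a+1,2b+2c+2d+5)\\ &+4\,\zeta(2a+2b+2,2c+2d+4)+4\,\zeta(\overline{2a+2b+2c+4},\overline{2d+2})\\ &+8\,\zeta(2a+1,2b+1,2c+2d+4)+8\,\zeta(2a+1,\overline{2b+2c+3},\overline{2d+2})\\ &+8\,\zeta(2a+2b+2,\overline{2c+2},\overline{2d+2})+16\,\zeta(2a+1,2b+1,\overline{2c+2},\overline{2d+2}). \end{aligned}$$ (2) For all integers $a,b,c,d\ge0$ and every real $q$ with $0<q<1$, all the series below converge absolutely and $$\begin{aligned} \zeta^{\star}[\{2\}^{a},1,\{2\}^{b},1,\{2\}^{c},3,\{2\}^{d},1]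 ={}&\mathfrak{z}[2a+2b+2c+2d+6;\,a+b+c+d+4;\,2]\\ &+\mathfrak{z}[2a+1,2b+2c+2d+5;\,a+1,b+c+d+3;\,2,0]\\ &+\mathfrak{z}[2a+2b+2,2c+2d+4;\,a+b+2,c+d+2;\,2,0]\\ &+\mathfrak{z}[\overline{2a+2b+2c+4},\overline{2d+2};\,a+b+c+3,d+1;\,1,1]\\ &+\mathfrak{z}[2a+1,2b+1,2c+2d+4;\,a+1,b+1,c+d+2;\,2,0,0]\\ &+\mathfrak{z}[2a+1,\overline{2b+2c+3},\overline{2d+2};\,a+1,b+c+2,d+1;\,2,-1,1]\\ &+\mathfrak{z}[2a+2b+2,\overline{2c+2},\overline{2d+2};\,a+b+2,c+1,d+1;\,2,-1,1]\\ &+\mathfrak{z}[2a+1,2b+1,\overline{2c+2},\overline{2d+2};\,a+1,b+1,c+1,d+1;\,2,0,-1,1]. \end{aligned}$$ -/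

import Mathlib

noncomputable section

namespace QMZV

/-- A signed number: either `k` (`pos k`) or its barred version (`bar k`), with `k : ℕ`. -/
inductive SignedNat where
  | pos (k : ℕ)
  | bar (k : ℕ)

/-- The absolute value: `|k| = |bar k| = k`. -/
def SignedNat.abs : SignedNat → ℕ
  | .pos k => k
  | .bar k => k

/-- The sign: `sgn k = 1` and `sgn (bar k) = -1`. -/
def SignedNat.sgn : SignedNat → ℝ
  | .pos _ => 1
  | .bar _ => -1

/-- Index tuples `k₁ > ⋯ > k_m ≥ 1`. -/
abbrev StrictTuple (m : ℕ) : Type :=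
  {k : Fin m → ℕ // StrictAnti k ∧ ∀ j, 1 ≤ k j}

/-- Index tuples `k₁ ≥ ⋯ ≥ k_m ≥ 1`. -/
abbrev WeakTuple (m : ℕ) : Type :=
  {k : Fin m → ℕ // Antitone k ∧ ∀ j, 1 ≤ k j}

/-! ### Alternating Euler sums -/

/-- The summand `∏ⱼ sgn(sⱼ)^{kⱼ} / kⱼ^{|sⱼ|}`. -/
def eulerTerm {m : ℕ} (s : Fin m → SignedNat) (k : Fin m → ℕ) : ℝ :=
  ∏ j, (s j).sgn ^ k j / (k j : ℝ) ^ (s j).abs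

/-- Absolute convergence of the series that defines `ζ(s)`. -/
def EulerConverges {m : ℕ} (s : Fin m → SignedNat) : Prop :=
  Summable fun k : StrictTuple m => eulerTerm s k.1

/-- The alternating Euler sum `ζ(s)`. -/
def euler {m : ℕ} (s : Fin m → SignedNat) : ℝ :=
  ∑' k : StrictTuple m, eulerTerm s k.1

/-- Absolute convergence of the series that defines `ζ⋆(s)`. -/
def EulerStarConverges {m : ℕ} (s : Fin m → SignedNat) : Prop :=
  Summable fun k : WeakTuple m => eulerTerm s k.1

/-- The star version `ζ⋆(s)`. -/
def eulerStar {m : ℕ} (s : Fin m → SignedNat) : ℝ :=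
  ∑' k : WeakTuple m, eulerTerm s k.1

/-! ### q-analogs -/

/-- The `q`-integer `[n] = 1 + q + ⋯ + q^{n-1}`. -/
def qInt (q : ℝ) (n : ℕ) : ℝ :=
  ∑ i ∈ Finset.range n, q ^ i

/-- The summand `∏ⱼ sgn(sⱼ)^{kⱼ} q^{kⱼ} / [kⱼ]^{|sⱼ|}`. -/
def qTerm (q : ℝ) {m : ℕ} (s : Fin m → SignedNat) (k : Fin m → ℕ) : ℝ :=
  ∏ j, (s j).sgn ^ k j * q ^ k j / qInt q (k j) ^ (s j).abs

/-- Absolute convergence of the series that defines `ζ⋆[s]`. -/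
def QStarConverges (q : ℝ) {m : ℕ} (s : Fin m → SignedNat) : Prop :=
  Summable fun k : WeakTuple m => qTerm q s k.1

/-- The `q`-multiple zeta star value `ζ⋆[s]`. -/
def qStar (q : ℝ) {m : ℕ} (s : Fin m → SignedNat) : ℝ :=
  ∑' k : WeakTuple m, qTerm q s k.1

/-- The set `ℤ ∪ {θ}`. -/
inductive IntTheta where
  | int (r : ℤ)
  | theta

/-- `Q(r,k)` is `r k (k-1) / 2` for `r > 0`, `r k (k-1) / 2 - k` for `r ≤ 0`, and `0` for `r = θ`;
the division is exact. -/
def Q : IntTheta → ℕ → ℤ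
  | .int r, k =>
      if 0 < r then r * (k : ℤ) * ((k : ℤ) - 1) / 2 else r * (k : ℤ) * ((k : ℤ) - 1) / 2 - (k : ℤ)
  | .theta, _ => 0

/-- The summand `∏ⱼ sgn(sⱼ)^{kⱼ} q^{tⱼ kⱼ + Q(rⱼ,kⱼ)} (1 + q^{kⱼ}) / [kⱼ]^{|sⱼ|}`. -/
def mollTerm (q : ℝ) {m : ℕ} (s : Fin m → SignedNat) (t : Fin m → ℕ) (r : Fin m → IntTheta)
    (k : Fin m → ℕ) : ℝ :=
  ∏ j, (s j).sgn ^ k j * q ^ ((t j : ℤ) * (k j : ℤ) + Q (r j) (k j)) * (1 + q ^ k j) /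
    qInt q (k j) ^ (s j).abs

/-- Absolute convergence of the series that defines `𝔷[s; t; r]`. -/
def MollConverges (q : ℝ) {m : ℕ} (s : Fin m → SignedNat) (t : Fin m → ℕ)
    (r : Fin m → IntTheta) : Prop :=
  Summable fun k : StrictTuple m => mollTerm q s t r k.1

/-- The mollified companion `𝔷[s; t; r]`. -/
def moll (q : ℝ) {m : ℕ} (s : Fin m → SignedNat) (t : Fin m → ℕ) (r : Fin m → IntTheta) : ℝ :=
  ∑' k : StrictTuple m, mollTerm q s t r k.1

/-- The string `({2}^a, 1, {2}^b, 1, {2}^c, 3, {2}^d, 1)`. -/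
def keyString (a b c d : ℕ) : List SignedNat :=
  List.replicate a (.pos 2) ++ [.pos 1] ++ List.replicate b (.pos 2) ++ [.pos 1] ++
    List.replicate c (.pos 2) ++ [.pos 3] ++ List.replicate d (.pos 2) ++ [.pos 1]

end QMZV

end

open QMZV

namespace QMZV

/-! ### `q`-integers -/

/-! A truncated star sum is expanded in the kernel $K(n,k)=[n]!^2/([n-k]!\,[n+k]!)$, that is,
written as $T_n(\alpha)=\sum_{k\le n}K(n,k)\,q^{k(k-1)}(1+q^k)\,\alpha_k$ with coefficients $\alpha$
independent of $n$. Prefixing an entry to the string then acts on $\alpha$ alone.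

Two identities drive this. By `kernel_sub`, the increment of $T_n(\beta)$ in $n$ is $q^n/[n]^2$
times the transform of $q^{-k}[k]^2\beta_k$, so an entry 2 multiplies $\alpha_k$ by $q^k/[k]^2$
(`sum_two`). By `qInt_mul_transform`, multiplication by $[n]$ replaces $\varphi_k$ by
$[k]\bigl(\varphi_k+\sum_{j<k}(q^{-j}+1)\varphi_j\bigr)$. An entry 1 applies this operator
(`sum_one`); an entry 3 applies its inverse (`sum_three`), and solving that recurrence creates the
signs and the powers $q^{\pm k(k-1)/2}$.

The rightmost 1 gives one monomial. Each of the other two 1s, and the 3, either leaves the summation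
index alone or introduces a new smaller one: $2^3=8$ terms in all, which is `truncStar_keyString`,
an identity valid for every $n$.

As $n\to\infty$, $K(n,k)\to1$ with $0\le K\le1$, so dominated convergence gives the right side; the
left side has nonnegative terms, so its convergence comes for free. All of this works for $0<q\le1$.
Part (1) is the case $q=1$, where every factor $1+q^k$ becomes 2. -/

lemma qInt_zero (q : ℝ) : qInt q 0 = 0 := by simp [qInt]

lemma qInt_add (q : ℝ) (m n : ℕ) : qInt q (m + n) = qInt q m + q ^ m * qInt q n := by
  simp [qInt, Finset.sum_range_add, pow_add, Finset.mul_sum]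

lemma qInt_two_mul (q : ℝ) (k : ℕ) : qInt q (k + k) = (1 + q ^ k) * qInt q k := by
  rw [qInt_add]; ring

lemma qInt_nonneg {q : ℝ} (hq : 0 < q) (n : ℕ) : 0 ≤ qInt q n :=
  Finset.sum_nonneg fun _ _ => by positivity

lemma one_le_qInt {q : ℝ} (hq : 0 < q) {n : ℕ} (hn : 1 ≤ n) : 1 ≤ qInt q n := by
  obtain ⟨m, rfl⟩ := Nat.exists_eq_add_of_le hn
  rw [qInt_add]
  have := mul_nonneg hq.le (qInt_nonneg hq m)
  simpa [qInt] using this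

lemma qInt_pos {q : ℝ} (hq : 0 < q) {n : ℕ} (hn : 1 ≤ n) : 0 < qInt q n :=
  one_pos.trans_le (one_le_qInt hq hn)

lemma qInt_mono {q : ℝ} (hq : 0 < q) {m n : ℕ} (h : m ≤ n) : qInt q m ≤ qInt q n := by
  obtain ⟨d, rfl⟩ := Nat.exists_eq_add_of_le h
  rw [qInt_add]
  have := mul_nonneg (pow_pos hq m).le (qInt_nonneg hq d)
  linarith

lemma qInt_one (n : ℕ) : qInt 1 n = n := by simp [qInt]

/-- Each of the $n$ summands of $[n]$ is at least $q^n$. This bound lets the kernel limit treat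
$q<1$ and $q=1$ together. -/
lemma natCast_mul_pow_le_qInt {q : ℝ} (hq : 0 < q) (hq1 : q ≤ 1) (n : ℕ) :
    n * q ^ n ≤ qInt q n := by
  calc (n : ℝ) * q ^ n = ∑ _i ∈ Finset.range n, q ^ n := by simp
    _ ≤ qInt q n := Finset.sum_le_sum fun i hi =>
        pow_le_pow_of_le_one hq.le hq1 (Finset.mem_range.1 hi).le

/-! ### The connecting kernel -/

/-- The kernel `[n]!² / ([n-k]! [n+k]!)`, which vanishes for `k > n`. -/
noncomputable def kernel (q : ℝ) (n k : ℕ) : ℝ :=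
  ∏ i ∈ Finset.range k, qInt q (n - i) / qInt q (n + i + 1)

lemma kernel_zero (q : ℝ) (n : ℕ) : kernel q n 0 = 1 := by simp [kernel]

lemma kernel_eq_zero (q : ℝ) {n k : ℕ} (h : n < k) : kernel q n k = 0 :=
  Finset.prod_eq_zero (Finset.mem_range.2 h) (by simp [qInt_zero])

lemma kernel_nonneg {q : ℝ} (hq : 0 < q) (n k : ℕ) : 0 ≤ kernel q n k :=
  Finset.prod_nonneg fun _ _ => div_nonneg (qInt_nonneg hq _) (qInt_nonneg hq _)

lemma kernel_le_one {q : ℝ} (hq : 0 < q) (n k : ℕ) : kernel q n k ≤ 1 :=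
  Finset.prod_le_one (fun _ _ => div_nonneg (qInt_nonneg hq _) (qInt_nonneg hq _)) fun i _ =>
    div_le_one_of_le₀ (qInt_mono hq (by omega)) (qInt_nonneg hq _)

lemma kernel_succ_right {q : ℝ} (hq : 0 < q) (n k : ℕ) :
    qInt q (n + k + 1) * kernel q n (k + 1) = qInt q (n - k) * kernel q n k := by
  have := (qInt_pos hq (show 1 ≤ n + k + 1 by omega)).ne'
  rw [kernel, Finset.prod_range_succ, ← kernel]
  field_simp

lemma kernel_succ_left {q : ℝ} (hq : 0 < q) (n k : ℕ) :
    qInt q (n + 1) ^ 2 * kernel q n k =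
      qInt q (n + 1 - k) * qInt q (n + 1 + k) * kernel q (n + 1) k := by
  induction k with
  | zero => simp [kernel_zero, sq]
  | succ k ih =>
    have h1 := (qInt_pos hq (show 1 ≤ n + k + 1 by omega)).ne'
    have e1 := kernel_succ_right hq n k
    have e2 := kernel_succ_right hq (n + 1) k
    have e3 : n + 1 - (k + 1) = n - k := by omega
    have e4 : n + 1 + k = n + k + 1 := by omega
    have e5 : n + 1 + (k + 1) = n + 1 + k + 1 := by omega
    rw [e3, e5]
    -- The recursion in $k$, taken at $n$ and at $n+1$, reduces the claim to the induction
    -- hypothesis after multiplying by $[n+k+1]$.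
    rw [e4] at ih
    apply mul_left_cancel₀ h1
    linear_combination qInt q (n + 1) ^ 2 * e1 + qInt q (n - k) * ih
      - qInt q (n + k + 1) * qInt q (n - k) * e2

lemma qInt_sq_sub (q : ℝ) {n k : ℕ} (h : k ≤ n) :
    q ^ k * (qInt q n ^ 2 - qInt q (n - k) * qInt q (n + k)) = q ^ n * qInt q k ^ 2 := by
  obtain ⟨d, rfl⟩ := Nat.exists_eq_add_of_le h
  have e1 : k + d - k = d := by omega
  have e2 : k + d + k = d + (k + k) := by omega
  have e3 : qInt q k + q ^ k * qInt q d = qInt q d + q ^ d * qInt q k := by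
    rw [← qInt_add, ← qInt_add, add_comm]
  rw [e1, e2, qInt_add q d, qInt_two_mul, qInt_add q k d, pow_add]
  linear_combination q ^ k * (qInt q k + q ^ k * qInt q d + qInt q d) * e3

/-- The ratio $K(n,k)/K(n+1,k)$ is $[n+1-k][n+1+k]/[n+1]^2$, and its distance from 1 is computed by
`qInt_sq_sub`. The dependence on $n$ and on $k$ separates, which is what makes the transform
compatible with prefixing. -/
lemma kernel_sub {q : ℝ} (hq : 0 < q) {n k : ℕ} (h : k ≤ n + 1) :
    kernel q (n + 1) k - kernel q n k =
      q ^ (n + 1) / qInt q (n + 1) ^ 2 * (kernel q (n + 1) k * ((q ^ k)⁻¹ * qInt q k ^ 2)) := by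
  have h1 := (qInt_pos hq (show 1 ≤ n + 1 by omega)).ne'
  have h2 := (pow_pos hq k).ne'
  field_simp
  linear_combination kernel q (n + 1) k * qInt_sq_sub q h - q ^ k * kernel_succ_left hq n k

lemma tendsto_kernel {q : ℝ} (hq : 0 < q) (hq1 : q ≤ 1) (k : ℕ) :
    Filter.Tendsto (fun n => kernel q n k) Filter.atTop (nhds 1) := by
  have key : ∀ i : ℕ, Filter.Tendsto (fun n => qInt q (n - i) / qInt q (n + i + 1))
      Filter.atTop (nhds 1) := by
    intro i
    -- Squeeze: each factor is $1-q^{n-i}[2i+1]/[n+i+1]$, and $(n-i)q^{n-i}\le[n-i]\le[n+i+1]$.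
    have hlim : Filter.Tendsto (fun n : ℕ => 1 - qInt q (2 * i + 1) / ((n - i : ℕ) : ℝ))
        Filter.atTop (nhds 1) := by
      have : Filter.Tendsto (fun n : ℕ => ((n - i : ℕ) : ℝ)) Filter.atTop Filter.atTop :=
        tendsto_natCast_atTop_atTop.comp (Filter.tendsto_sub_atTop_nat i)
      simpa using (this.const_div_atTop (qInt q (2 * i + 1))).const_sub 1
    refine tendsto_of_tendsto_of_tendsto_of_le_of_le' hlim tendsto_const_nhds ?_ ?_
    · filter_upwards [Filter.eventually_gt_atTop i] with n hn
      have e : n + i + 1 = (n - i) + (2 * i + 1) := by omega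
      have hp : 0 < qInt q (n + i + 1) := qInt_pos hq (by omega)
      have hn0 : (0 : ℝ) < ((n - i : ℕ) : ℝ) := by exact_mod_cast Nat.sub_pos_of_lt hn
      have h0 := qInt_nonneg hq (2 * i + 1)
      have h1 := natCast_mul_pow_le_qInt hq hq1 (n - i)
      have h2 := qInt_mono hq (show n - i ≤ n + i + 1 by omega)
      have h3 : qInt q (n - i) = qInt q (n + i + 1) - q ^ (n - i) * qInt q (2 * i + 1) := by
        rw [e, qInt_add]; ring
      rw [h3, sub_div, div_self hp.ne']
      refine sub_le_sub_left ?_ 1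
      rw [div_le_div_iff₀ hp hn0]
      nlinarith [mul_le_mul_of_nonneg_left (h1.trans h2) h0]
    · exact Filter.Eventually.of_forall fun n =>
        div_le_one_of_le₀ (qInt_mono hq (by omega)) (qInt_nonneg hq _)
  simpa [kernel] using tendsto_finsetProd (Finset.range k) fun i _ => key i

/-! ### The kernel transform -/

/-- The transform `∑_{k=1}^n K(n,k) q^{k(k-1)} (1+q^k) α_k`. -/
noncomputable def transform (q : ℝ) (n : ℕ) (α : ℕ → ℝ) : ℝ :=
  ∑ k ∈ Finset.Icc 1 n, kernel q n k * (q ^ (k * (k - 1)) * (1 + q ^ k)) * α k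

lemma transform_congr {q : ℝ} {n : ℕ} {α β : ℕ → ℝ} (h : ∀ k, 1 ≤ k → α k = β k) :
    transform q n α = transform q n β :=
  Finset.sum_congr rfl fun k hk => by rw [h k (Finset.mem_Icc.1 hk).1]

lemma transform_succ {q : ℝ} (hq : 0 < q) (n : ℕ) (β : ℕ → ℝ) :
    transform q (n + 1) β = transform q n β + q ^ (n + 1) / qInt q (n + 1) ^ 2 *
      transform q (n + 1) fun k => (q ^ k)⁻¹ * qInt q k ^ 2 * β k := by
  -- The sum may run to $n+1$ because $K(n,n+1)=0$.
  have h : transform q n β = ∑ k ∈ Finset.Icc 1 (n + 1),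
      kernel q n k * (q ^ (k * (k - 1)) * (1 + q ^ k)) * β k := by
    rw [Finset.sum_Icc_succ_top (by omega), kernel_eq_zero q (Nat.lt_succ_self n), transform]
    simp
  rw [h, transform, transform, Finset.mul_sum, ← Finset.sum_add_distrib]
  refine Finset.sum_congr rfl fun k hk => ?_
  linear_combination (q ^ (k * (k - 1)) * (1 + q ^ k)) * β k *
    kernel_sub hq (Finset.mem_Icc.1 hk).2

/-- Telescoping: the hypothesis says that $g(n)$ is the increment of the transform of $\beta$ given
by `transform_succ`. -/
lemma sum_eq_transform {q : ℝ} (hq : 0 < q) {g β : ℕ → ℝ}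
    (h : ∀ n, 1 ≤ n → g n =
      q ^ n / qInt q n ^ 2 * transform q n fun k => (q ^ k)⁻¹ * qInt q k ^ 2 * β k) (n : ℕ) :
    ∑ m ∈ Finset.Icc 1 n, g m = transform q n β := by
  induction n with
  | zero => simp [transform]
  | succ n ih =>
    rw [Finset.sum_Icc_succ_top (by omega), ih, transform_succ hq, h (n + 1) (by omega)]

/-- Multiplication by `[n]` in terms of the coefficients. -/
lemma qInt_mul_transform {q : ℝ} (hq : 0 < q) (n : ℕ) {φ S : ℕ → ℝ}
    (hS : ∀ k, S (k + 1) = S k + ((q ^ (k + 1))⁻¹ + 1) * φ (k + 1)) :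
    transform q n (fun k => qInt q k * (φ k + S (k - 1))) =
      qInt q n * (S 0 + transform q n φ) := by
  -- Summation by parts with an explicit boundary term, which vanishes at $N=n$ because it contains
  -- $[n-N]$.
  have key : ∀ N, N ≤ n →
      ∑ k ∈ Finset.Icc 1 N, kernel q n k * (q ^ (k * (k - 1)) * (1 + q ^ k)) *
        (qInt q k * (φ k + S (k - 1))) =
      qInt q n * (S 0 + ∑ k ∈ Finset.Icc 1 N,
        kernel q n k * (q ^ (k * (k - 1)) * (1 + q ^ k)) * φ k)
        - S N * q ^ (N * (N + 1)) * (qInt q (n - N) * kernel q n N) := by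
    intro N
    induction N with
    | zero => simp [kernel_zero]; ring
    | succ N ih =>
      intro hN
      rw [Finset.sum_Icc_succ_top (by omega), Finset.sum_Icc_succ_top (by omega),
        ih (by omega), ← kernel_succ_right hq, hS N, Nat.add_sub_cancel]
      have e1 : qInt q n = qInt q (N + 1) + q ^ (N + 1) * qInt q (n - (N + 1)) := by
        rw [← qInt_add]; congr 1; omega
      have e2 : qInt q (n + N + 1) = (1 + q ^ (N + 1)) * qInt q (N + 1) +
          q ^ (N + 1) * q ^ (N + 1) * qInt q (n - (N + 1)) := by
        rw [← qInt_two_mul, ← pow_add, ← qInt_add]; congr 1; omega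
      have e3 : q ^ ((N + 1) * (N + 1 + 1)) = q ^ ((N + 1) * N) * (q ^ (N + 1) * q ^ (N + 1)) := by
        rw [← pow_add, ← pow_add]; congr 1; ring
      have e4 : N * (N + 1) = (N + 1) * N := mul_comm _ _
      have h2 : q ^ (N + 1) * (q ^ (N + 1))⁻¹ = 1 := mul_inv_cancel₀ (pow_pos hq _).ne'
      rw [e3, e4, e2]
      generalize (q ^ (N + 1))⁻¹ = p at *
      generalize q ^ (N + 1) = x at *
      rw [e1]
      linear_combination (kernel q n (N + 1) * q ^ ((N + 1) * N) * φ (N + 1) *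
        x * qInt q (n - (N + 1))) * h2
  have := key n le_rfl
  rw [transform, transform, this]
  simp [qInt_zero]

/-- Prefixing the transform of `α` by an entry `2`. -/
lemma sum_two {q : ℝ} (hq : 0 < q) (α : ℕ → ℝ) (n : ℕ) :
    ∑ m ∈ Finset.Icc 1 n, q ^ m / qInt q m ^ 2 * transform q m α =
      transform q n fun k => q ^ k / qInt q k ^ 2 * α k := by
  refine sum_eq_transform hq (fun n hn => ?_) n
  congr 1
  refine transform_congr fun k hk => ?_
  have := (qInt_pos hq hk).ne'
  have := (pow_pos hq k).ne'
  field_simp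

/-- Write $1/[m]$ as $[m]/[m]^2$ and absorb $[m]$ by `qInt_mul_transform`. The free constant $S_0$
covers both uses: $S=1$, $\alpha=0$ for a lone entry 1, and $S_0=0$ for a prefixed one. -/
lemma sum_one_of_partial {q : ℝ} (hq : 0 < q) {α S : ℕ → ℝ}
    (hS : ∀ k, S (k + 1) = S k + ((q ^ (k + 1))⁻¹ + 1) * α (k + 1)) (n : ℕ) :
    ∑ m ∈ Finset.Icc 1 n, q ^ m / qInt q m * (S 0 + transform q m α) =
      transform q n fun k => q ^ k / qInt q k * (α k + S (k - 1)) := by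
  refine sum_eq_transform hq (fun n hn => ?_) n
  have hn0 := (qInt_pos hq hn).ne'
  rw [transform_congr (β := fun k => qInt q k * (α k + S (k - 1)))
    (α := fun k => (q ^ k)⁻¹ * qInt q k ^ 2 * _), qInt_mul_transform hq n hS]
  · field_simp
  · intro k hk
    have := (qInt_pos hq hk).ne'
    have := (pow_pos hq k).ne'
    field_simp

/-- The single entry `1`. -/
lemma sum_one_single {q : ℝ} (hq : 0 < q) (n : ℕ) :
    ∑ m ∈ Finset.Icc 1 n, q ^ m / qInt q m = transform q n fun k => q ^ k / qInt q k := by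
  simpa [transform] using sum_one_of_partial hq (α := fun _ => 0) (S := fun _ => 1) (by simp) n

/-- Prefixing the transform of `α` by an entry `1`. -/
lemma sum_one {q : ℝ} (hq : 0 < q) (α : ℕ → ℝ) (n : ℕ) :
    ∑ m ∈ Finset.Icc 1 n, q ^ m / qInt q m * transform q m α =
      transform q n fun k => q ^ k / qInt q k *
        (α k + ∑ j ∈ Finset.Icc 1 (k - 1), ((q ^ j)⁻¹ + 1) * α j) := by
  have := sum_one_of_partial hq (α := α)
    (S := fun k => ∑ j ∈ Finset.Icc 1 k, ((q ^ j)⁻¹ + 1) * α j)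
    (fun k => Finset.sum_Icc_succ_top (by omega) _) n
  simpa using this

/-- Prefixing the transform of `α` by an entry `3`. -/
lemma sum_three {q : ℝ} (hq : 0 < q) (α : ℕ → ℝ) (n : ℕ) :
    ∑ m ∈ Finset.Icc 1 n, q ^ m / qInt q m ^ 3 * transform q m α =
      transform q n fun k => q ^ k / qInt q k ^ 2 * (α k / qInt q k +
        (-1) ^ k * (q ^ k.choose 2)⁻¹ * ∑ j ∈ Finset.Icc 1 (k - 1),
          (-1) ^ j * q ^ j.choose 2 * (1 + q ^ j) * (α j / qInt q j)) := by
  -- Dividing by $[n]$ means solving $[k](\varphi_k+S_{k-1})=\alpha_k$, i.e.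
  -- $S_k=-q^{-k}S_{k-1}+(q^{-k}+1)\alpha_k/[k]$ with $S_0=0$. The integrating factor
  -- $(-1)^kq^{k(k+1)/2}$ turns this into the plain sum $V$.
  set V : ℕ → ℝ := fun k => ∑ j ∈ Finset.Icc 1 k,
    (-1) ^ j * q ^ j.choose 2 * (1 + q ^ j) * (α j / qInt q j) with hV
  set φ : ℕ → ℝ := fun k => α k / qInt q k + (-1) ^ k * (q ^ k.choose 2)⁻¹ * V (k - 1) with hφ
  set S : ℕ → ℝ := fun k => (-1) ^ k * (q ^ (k + 1).choose 2)⁻¹ * V k with hSdef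
  have hS : ∀ k, S (k + 1) = S k + ((q ^ (k + 1))⁻¹ + 1) * φ (k + 1) := by
    intro k
    have hVs : V (k + 1) = V k + (-1) ^ (k + 1) * q ^ (k + 1).choose 2 * (1 + q ^ (k + 1)) *
        (α (k + 1) / qInt q (k + 1)) := Finset.sum_Icc_succ_top (by omega) _
    have hc : (k + 1 + 1).choose 2 = (k + 1).choose 2 + (k + 1) := by
      rw [Nat.choose_succ_succ' (k + 1) 1]; simp; ring
    have h1 := (pow_pos hq (k + 1)).ne'
    have h2 := (pow_pos hq ((k + 1).choose 2)).ne'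
    have h3 : ((-1 : ℝ) ^ (k + 1)) * (-1) ^ (k + 1) = 1 := by
      rw [← mul_pow]; simp
    have h4 : ((-1 : ℝ) ^ k) = - (-1) ^ (k + 1) := by rw [pow_succ]; ring
    simp only [hSdef, hφ, Nat.add_sub_cancel, hVs, hc, pow_add q _ (k + 1), h4]
    generalize (-1 : ℝ) ^ (k + 1) = s at *
    generalize q ^ (k + 1) = x at *
    generalize α (k + 1) / qInt q (k + 1) = y at *
    field_simp
    linear_combination (q ^ (k + 1).choose 2 * (1 + x) * y) * h3
  have hS0 : S 0 = 0 := by simp [hSdef, hV]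
  refine sum_eq_transform hq (fun n hn => ?_) n
  have hn0 := (qInt_pos hq hn).ne'
  have hmul := qInt_mul_transform hq n hS
  rw [hS0, zero_add] at hmul
  rw [transform_congr (β := fun k => qInt q k * (φ k + S (k - 1))) (α := α), hmul,
    transform_congr (β := φ) (α := fun k => (q ^ k)⁻¹ * qInt q k ^ 2 * (q ^ k / qInt q k ^ 2 * _))]
  · field_simp
  · intro k hk
    have := (qInt_pos hq hk).ne'
    have := (pow_pos hq k).ne'
    simp only [hφ, hV]
    field_simp
  · intro k hk
    obtain ⟨j, rfl⟩ := Nat.exists_eq_add_of_le' hk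
    have := (qInt_pos hq hk).ne'
    simp only [hφ, hSdef, Nat.add_sub_cancel, pow_succ (-1 : ℝ)]
    field_simp
    ring

/-! ### Index tuples with bounded entries -/

/-- The tuples in `[1, n]^m` that decrease by at least `e` from each entry to the later ones. -/
def gapTuples (e n m : ℕ) : Finset (Fin m → ℕ) :=
  {k ∈ Fintype.piFinset fun _ : Fin m => Finset.Icc 1 n | ∀ i j, i < j → k j + e ≤ k i}

lemma mem_gapTuples {e n m : ℕ} {k : Fin m → ℕ} :
    k ∈ gapTuples e n m ↔ (∀ j, 1 ≤ k j ∧ k j ≤ n) ∧ ∀ i j, i < j → k j + e ≤ k i := by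
  simp [gapTuples]

lemma mem_gapTuples_one {n m : ℕ} {k : Fin m → ℕ} :
    k ∈ gapTuples 1 n m ↔ (StrictAnti k ∧ ∀ j, 1 ≤ k j) ∧ ∀ j, k j ≤ n := by
  rw [mem_gapTuples, forall_and]
  constructor
  · rintro ⟨⟨h1, h2⟩, h3⟩
    exact ⟨⟨fun i j hij => h3 i j hij, h1⟩, h2⟩
  · rintro ⟨⟨h3, h1⟩, h2⟩
    exact ⟨⟨h1, h2⟩, fun i j hij => h3 hij⟩

lemma mem_gapTuples_zero {n m : ℕ} {k : Fin m → ℕ} :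
    k ∈ gapTuples 0 n m ↔ (Antitone k ∧ ∀ j, 1 ≤ k j) ∧ ∀ j, k j ≤ n := by
  rw [mem_gapTuples, forall_and]
  constructor
  · rintro ⟨⟨h1, h2⟩, h3⟩
    refine ⟨⟨fun i j hij => ?_, h1⟩, h2⟩
    rcases hij.eq_or_lt with rfl | h
    · exact le_rfl
    · exact h3 i j h
  · rintro ⟨⟨h3, h1⟩, h2⟩
    exact ⟨⟨h1, h2⟩, fun i j hij => h3 hij.le⟩

lemma sum_gapTuples_zero (e n : ℕ) (F : (Fin 0 → ℕ) → ℝ) :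
    ∑ k ∈ gapTuples e n 0, F k = F ![] := by
  have : gapTuples e n 0 = {![]} := by
    ext k
    simp [mem_gapTuples, Subsingleton.elim k ![]]
  simp [this]

/-- The truncated subtraction in $x-e$ is harmless, since the later entries are at least 1. -/
lemma cons_mem_gapTuples {e n m x : ℕ} {k : Fin m → ℕ} :
    (Fin.cons x k : Fin (m + 1) → ℕ) ∈ gapTuples e n (m + 1) ↔
      x ∈ Finset.Icc 1 n ∧ k ∈ gapTuples e (x - e) m := by
  simp only [mem_gapTuples, Finset.mem_Icc, Fin.forall_fin_succ, Fin.cons_zero, Fin.cons_succ,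
    Fin.succ_pos, Fin.not_lt_zero, Fin.succ_lt_succ_iff, false_imp_iff, true_imp_iff,
    true_and]
  constructor
  · rintro ⟨⟨h1, h2⟩, h3, h4⟩
    exact ⟨h1, fun j => ⟨(h2 j).1, by have := h3 j; omega⟩, h4⟩
  · rintro ⟨h1, h2, h3⟩
    refine ⟨⟨h1, fun j => ⟨(h2 j).1, ?_⟩⟩, fun j => ?_, h3⟩
    all_goals have := h2 j; omega

lemma sum_gapTuples_succ (e n m : ℕ) (F : (Fin (m + 1) → ℕ) → ℝ) :
    ∑ k ∈ gapTuples e n (m + 1), F k =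
      ∑ x ∈ Finset.Icc 1 n, ∑ k ∈ gapTuples e (x - e) m, F (Fin.cons x k) := by
  rw [Finset.sum_sigma']
  refine Finset.sum_bij' (fun k _ => ⟨k 0, Fin.tail k⟩) (fun p _ => Fin.cons p.1 p.2)
    ?_ ?_ ?_ ?_ ?_
  · intro k hk
    rw [← Fin.cons_self_tail k, cons_mem_gapTuples] at hk
    simpa using hk
  · intro p hp
    simpa [cons_mem_gapTuples] using hp
  · intro k _
    exact Fin.cons_self_tail k
  · intro p _
    simp
  · intro k _
    rw [Fin.cons_self_tail]

/-! ### Truncated star sums -/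

/-- The star sum over the tuples with `k₁ ≤ n`. -/
noncomputable def truncStar (q : ℝ) (n : ℕ) (l : List SignedNat) : ℝ :=
  ∑ k ∈ gapTuples 0 n l.length, qTerm q l.get k

lemma truncStar_nil (q : ℝ) (n : ℕ) : truncStar q n [] = 1 := by
  have := sum_gapTuples_zero 0 n fun k => qTerm q ([] : List SignedNat).get k
  rw [truncStar]
  refine this.trans ?_
  simp [qTerm]

lemma truncStar_cons (q : ℝ) (n : ℕ) (s : SignedNat) (l : List SignedNat) :
    truncStar q n (s :: l) = ∑ x ∈ Finset.Icc 1 n,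
      s.sgn ^ x * q ^ x / qInt q x ^ s.abs * truncStar q x l := by
  have := sum_gapTuples_succ 0 n l.length fun k => qTerm q (s :: l).get k
  rw [truncStar]
  refine this.trans ?_
  refine Finset.sum_congr rfl fun x _ => ?_
  rw [truncStar, Finset.mul_sum]
  refine Finset.sum_congr rfl fun k _ => ?_
  refine (Fin.prod_univ_succ (n := l.length) _).trans ?_
  simp [qTerm]

lemma truncStar_two_cons {q : ℝ} (hq : 0 < q) {l : List SignedNat} {α : ℕ → ℝ}
    (h : ∀ n, truncStar q n l = transform q n α) (n : ℕ) :
    truncStar q n (.pos 2 :: l) = transform q n fun k => q ^ k / qInt q k ^ 2 * α k := by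
  rw [truncStar_cons, ← sum_two hq]
  simp [SignedNat.sgn, SignedNat.abs, h]

lemma truncStar_replicate_two {q : ℝ} (hq : 0 < q) {l : List SignedNat} {α : ℕ → ℝ}
    (h : ∀ n, truncStar q n l = transform q n α) (a n : ℕ) :
    truncStar q n (List.replicate a (.pos 2) ++ l) =
      transform q n fun k => q ^ (a * k) / qInt q k ^ (2 * a) * α k := by
  induction a generalizing n with
  | zero => simp [h]
  | succ a ih =>
    rw [List.replicate_succ, List.cons_append, truncStar_two_cons hq ih]
    refine transform_congr fun k _ => ?_
    rw [← mul_assoc, div_mul_div_comm, ← pow_add, ← pow_add]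
    congr 3 <;> ring

lemma truncStar_one_cons {q : ℝ} (hq : 0 < q) {l : List SignedNat} {α : ℕ → ℝ}
    (h : ∀ n, truncStar q n l = transform q n α) (n : ℕ) :
    truncStar q n (.pos 1 :: l) = transform q n fun k => q ^ k / qInt q k *
        (α k + ∑ j ∈ Finset.Icc 1 (k - 1), ((q ^ j)⁻¹ + 1) * α j) := by
  rw [truncStar_cons, ← sum_one hq]
  simp [SignedNat.sgn, SignedNat.abs, h]

lemma truncStar_three_cons {q : ℝ} (hq : 0 < q) {l : List SignedNat} {α : ℕ → ℝ}
    (h : ∀ n, truncStar q n l = transform q n α) (n : ℕ) :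
    truncStar q n (.pos 3 :: l) = transform q n fun k => q ^ k / qInt q k ^ 2 *
      (α k / qInt q k + (-1) ^ k * (q ^ k.choose 2)⁻¹ * ∑ j ∈ Finset.Icc 1 (k - 1),
          (-1) ^ j * q ^ j.choose 2 * (1 + q ^ j) * (α j / qInt q j)) := by
  rw [truncStar_cons, ← sum_three hq]
  simp [SignedNat.sgn, SignedNat.abs, h]

lemma truncStar_one {q : ℝ} (hq : 0 < q) (n : ℕ) :
    truncStar q n [.pos 1] = transform q n fun k => q ^ k / qInt q k := by
  rw [truncStar_cons, ← sum_one_single hq]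
  simp [SignedNat.sgn, SignedNat.abs, truncStar_nil]

/-! ### Truncated mollified sums -/

/-- One factor of `mollTerm`. -/
noncomputable def mollFactor (q : ℝ) (s : SignedNat) (t : ℕ) (r : IntTheta) (k : ℕ) : ℝ :=
  s.sgn ^ k * q ^ ((t : ℤ) * (k : ℤ) + Q r k) * (1 + q ^ k) / qInt q k ^ s.abs

/-- The sum of `mollTerm` over the tuples with `k₁ ≤ n`. -/
noncomputable def truncMoll (q : ℝ) (n : ℕ) {m : ℕ} (s : Fin m → SignedNat) (t : Fin m → ℕ)
    (r : Fin m → IntTheta) : ℝ :=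
  ∑ k ∈ gapTuples 1 n m, mollTerm q s t r k

/-- The sum of `mollTerm` over the tuples with `k₁ ≤ n`, weighted by the kernel at `(n, k₁)`. -/
noncomputable def kernelMoll (q : ℝ) (n : ℕ) {m : ℕ} (s : Fin (m + 1) → SignedNat)
    (t : Fin (m + 1) → ℕ) (r : Fin (m + 1) → IntTheta) : ℝ :=
  ∑ k ∈ gapTuples 1 n (m + 1), kernel q n (k 0) * mollTerm q s t r k

lemma mollTerm_cons (q : ℝ) {m : ℕ} (s : Fin (m + 1) → SignedNat) (t : Fin (m + 1) → ℕ)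
    (r : Fin (m + 1) → IntTheta) (x : ℕ) (k : Fin m → ℕ) :
    mollTerm q s t r (Fin.cons x k) = mollFactor q (s 0) (t 0) (r 0) x *
      mollTerm q (Fin.tail s) (Fin.tail t) (Fin.tail r) k := by
  rw [mollTerm, mollTerm, Fin.prod_univ_succ]
  simp [mollFactor, Fin.tail]

lemma truncMoll_zero (q : ℝ) (n : ℕ) (s : Fin 0 → SignedNat) (t : Fin 0 → ℕ)
    (r : Fin 0 → IntTheta) : truncMoll q n s t r = 1 := by
  rw [truncMoll, sum_gapTuples_zero]
  simp [mollTerm]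

lemma truncMoll_cons (q : ℝ) (n : ℕ) {m : ℕ} (s₀ : SignedNat) (t₀ : ℕ) (r₀ : IntTheta)
    (s : Fin m → SignedNat) (t : Fin m → ℕ) (r : Fin m → IntTheta) :
    truncMoll q n (Matrix.vecCons s₀ s) (Matrix.vecCons t₀ t) (Matrix.vecCons r₀ r) =
      ∑ x ∈ Finset.Icc 1 n, mollFactor q s₀ t₀ r₀ x * truncMoll q (x - 1) s t r := by
  rw [truncMoll, sum_gapTuples_succ]
  simp only [mollTerm_cons, truncMoll, Finset.mul_sum]
  rfl

lemma kernelMoll_cons (q : ℝ) (n : ℕ) {m : ℕ} (s₀ : SignedNat) (t₀ : ℕ) (r₀ : IntTheta)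
    (s : Fin m → SignedNat) (t : Fin m → ℕ) (r : Fin m → IntTheta) :
    kernelMoll q n (Matrix.vecCons s₀ s) (Matrix.vecCons t₀ t) (Matrix.vecCons r₀ r) =
      ∑ x ∈ Finset.Icc 1 n, kernel q n x *
        (mollFactor q s₀ t₀ r₀ x * truncMoll q (x - 1) s t r) := by
  rw [kernelMoll, sum_gapTuples_succ]
  simp only [mollTerm_cons, truncMoll, Finset.mul_sum, Fin.cons_zero]
  rfl

/-! ### Passage to the limit -/

lemma tendsto_kernelMoll {q : ℝ} (hq : 0 < q) (hq1 : q ≤ 1) {m : ℕ}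
    {s : Fin (m + 1) → SignedNat} {t : Fin (m + 1) → ℕ} {r : Fin (m + 1) → IntTheta}
    (h : MollConverges q s t r) :
    Filter.Tendsto (fun n => kernelMoll q n s t r) Filter.atTop (nhds (moll q s t r)) := by
  have hfin : ∀ n, kernelMoll q n s t r =
      ∑' k : StrictTuple (m + 1), kernel q n (k.1 0) * mollTerm q s t r k.1 := by
    intro n
    have h1 := tsum_subtype {k : Fin (m + 1) → ℕ | StrictAnti k ∧ ∀ j, 1 ≤ k j}
      fun k => kernel q n (k 0) * mollTerm q s t r k
    refine Eq.trans ?_ h1.symm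
    rw [tsum_eq_sum (s := gapTuples 1 n (m + 1))]
    · refine Finset.sum_congr rfl fun k hk => ?_
      rw [Set.indicator_of_mem]
      exact (mem_gapTuples_one.1 hk).1
    · intro k hk
      refine Set.indicator_apply_eq_zero.2 fun hk' => ?_
      have hk' : StrictAnti k ∧ ∀ j, 1 ≤ k j := hk'
      -- A strictly decreasing tuple outside the finite set has $k_1>n$, where the kernel vanishes.
      rw [kernel_eq_zero, zero_mul]
      by_contra! hle
      exact hk (mem_gapTuples_one.2 ⟨hk', fun j => (hk'.1.antitone (Fin.zero_le j)).trans hle⟩)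
  simp only [hfin, moll]
  refine tendsto_tsum_of_dominated_convergence h.norm (fun k => ?_)
    (Filter.Eventually.of_forall fun n k => ?_)
  · simpa using (tendsto_kernel hq hq1 (k.1 0)).mul_const (mollTerm q s t r k.1)
  · rw [norm_mul, Real.norm_of_nonneg (kernel_nonneg hq _ _)]
    exact mul_le_of_le_one_left (norm_nonneg _) (kernel_le_one hq _ _)

/-- Every finite set lies in some `A n`, so the limit of the increasing partial sums bounds all
finite sums. -/
lemma hasSum_of_tendsto_exhaustion {ι : Type*} {f : ι → ℝ} (hf : ∀ i, 0 ≤ f i)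
    {A : ℕ → Finset ι} (hA : Monotone A) (hA' : ∀ i, ∃ n, i ∈ A n) {L : ℝ}
    (h : Filter.Tendsto (fun n => ∑ i ∈ A n, f i) Filter.atTop (nhds L)) : HasSum f L := by
  have hlim := Filter.tendsto_atTop_finset_of_monotone hA hA'
  have hmono : Monotone fun n => ∑ i ∈ A n, f i := fun a b hab =>
    Finset.sum_le_sum_of_subset_of_nonneg (hA hab) fun i _ _ => hf i
  have hs : Summable f := by
    refine summable_of_sum_le (c := L) hf fun u => ?_
    obtain ⟨n, hn⟩ := (hlim.eventually (Filter.eventually_ge_atTop u)).exists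
    exact (Finset.sum_le_sum_of_subset_of_nonneg hn fun i _ _ => hf i).trans
      (hmono.ge_of_tendsto h n)
  have := tendsto_nhds_unique h (hs.hasSum.comp hlim)
  rw [this]
  exact hs.hasSum

lemma hasSum_qTerm_of_tendsto {q : ℝ} (hq : 0 < q) {l : List SignedNat}
    (hl : ∀ s ∈ l, s.sgn = 1) {L : ℝ}
    (h : Filter.Tendsto (fun n => truncStar q n l) Filter.atTop (nhds L)) :
    HasSum (fun k : WeakTuple l.length => qTerm q l.get k.1) L := by
  classical
  refine hasSum_of_tendsto_exhaustion
    (A := fun n => (gapTuples 0 n l.length).subtype _) ?_ ?_ ?_ ?_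
  · intro k
    refine Finset.prod_nonneg fun j _ => ?_
    rw [hl _ (List.get_mem l j), one_pow, one_mul]
    exact div_nonneg (pow_pos hq _).le (pow_nonneg (qInt_nonneg hq _) _)
  · intro a b hab k hk
    simp only [Finset.mem_subtype, mem_gapTuples_zero] at hk ⊢
    exact ⟨hk.1, fun j => (hk.2 j).trans hab⟩
  · intro k
    refine ⟨∑ j, k.1 j, ?_⟩
    simp only [Finset.mem_subtype, mem_gapTuples_zero]
    exact ⟨k.2, fun j => Finset.single_le_sum (fun _ _ => Nat.zero_le _) (Finset.mem_univ j)⟩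
  · refine h.congr fun n => ?_
    rw [Finset.sum_subtype_of_mem (fun k => qTerm q l.get k)
      (fun k hk => (mem_gapTuples_zero.1 hk).1), truncStar]

/-! ### The truncated identity -/

/-- The monomial `q^{tk} / [k]^s`. -/
noncomputable def qMono (q : ℝ) (s t k : ℕ) : ℝ := q ^ (t * k) / qInt q k ^ s

/-- The alternating monomial `(-1)^k q^{tk - k(k-1)/2} / [k]^s`. -/
noncomputable def qAltMono (q : ℝ) (s t k : ℕ) : ℝ :=
  (-1) ^ k * (q ^ k.choose 2)⁻¹ * qMono q s t k

lemma qMono_mul (q : ℝ) (s t s' t' k : ℕ) :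
    qMono q s t k * qMono q s' t' k = qMono q (s + s') (t + t') k := by
  rw [qMono, qMono, qMono, div_mul_div_comm, ← pow_add, ← pow_add, add_mul]

lemma qMono_mul_qAltMono (q : ℝ) (s t s' t' k : ℕ) :
    qMono q s t k * qAltMono q s' t' k = qAltMono q (s + s') (t + t') k := by
  rw [qAltMono, qAltMono, ← qMono_mul]; ring

lemma mul_pred_eq_choose (k : ℕ) : k * (k - 1) = k.choose 2 + k.choose 2 := by
  rw [Nat.choose_two_right, ← two_mul,
    Nat.mul_div_cancel' (Nat.even_mul_pred_self k).two_dvd]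

lemma cast_choose_two (k : ℕ) : (k : ℤ) * ((k : ℤ) - 1) = 2 * (k.choose 2 : ℤ) := by
  rcases k with _ | k
  · simp
  · have h : ((k : ℤ) + 1) * k = (k + 1).choose 2 + (k + 1).choose 2 := by
      exact_mod_cast mul_pred_eq_choose (k + 1)
    push_cast
    linarith

lemma Q_two (k : ℕ) : Q (.int 2) k = 2 * (k.choose 2 : ℤ) := by
  have h := cast_choose_two k
  have e : (2 : ℤ) * k * (k - 1) = 2 * (2 * (k.choose 2 : ℤ)) := by linear_combination 2 * h
  simp only [Q, e]
  simp

lemma Q_one (k : ℕ) : Q (.int 1) k = (k.choose 2 : ℤ) := by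
  have h := cast_choose_two k
  have e : (1 : ℤ) * k * (k - 1) = 2 * (k.choose 2 : ℤ) := by linear_combination h
  simp only [Q, e]
  simp

lemma Q_zero (k : ℕ) : Q (.int 0) k = -(k : ℤ) := by
  simp [Q]

lemma Q_neg_one (k : ℕ) : Q (.int (-1)) k = -(k.choose 2 : ℤ) - k := by
  have h := cast_choose_two k
  have e : (-1 : ℤ) * k * (k - 1) = 2 * -(k.choose 2 : ℤ) := by linear_combination -h
  simp only [Q, e, Int.mul_ediv_cancel_left _ (two_ne_zero : (2 : ℤ) ≠ 0)]
  simp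

/-- The parameter $r$ records the origin of an index: 2 for the weight of the transform, 0 for the
inner weight $q^{-j}+1$ of an entry 1, and $-1$ for that weight times the factor $q^{-\binom j2}$
left by the 3. The value 1 occurs for the sum inside the 3, and also when that factor meets the
transform weight, as in `mollFactor_int_one'`. -/
lemma mollFactor_int_two (q : ℝ) (s t k : ℕ) :
    mollFactor q (.pos s) t (.int 2) k = q ^ (k * (k - 1)) * (1 + q ^ k) * qMono q s t k := by
  have e : (t : ℤ) * k + Q (.int 2) k = ((k * (k - 1) + t * k : ℕ) : ℤ) := by
    rw [Q_two, mul_pred_eq_choose]; push_cast; ring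
  rw [mollFactor, e, zpow_natCast, pow_add, qMono]
  simp only [SignedNat.sgn, SignedNat.abs]
  ring

lemma mollFactor_int_one (q : ℝ) (s t k : ℕ) :
    mollFactor q (.bar s) t (.int 1) k =
      (-1) ^ k * q ^ k.choose 2 * (1 + q ^ k) * qMono q s t k := by
  have e : (t : ℤ) * k + Q (.int 1) k = ((k.choose 2 + t * k : ℕ) : ℤ) := by
    rw [Q_one]; push_cast; ring
  rw [mollFactor, e, zpow_natCast, pow_add, qMono]
  simp only [SignedNat.sgn, SignedNat.abs]
  ring

lemma mollFactor_int_one' {q : ℝ} (hq : 0 < q) (s t k : ℕ) :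
    mollFactor q (.bar s) t (.int 1) k = q ^ (k * (k - 1)) * (1 + q ^ k) * qAltMono q s t k := by
  have := (pow_pos hq (k.choose 2)).ne'
  rw [mollFactor_int_one, qAltMono, mul_pred_eq_choose, pow_add]
  field_simp

lemma mollFactor_int_zero {q : ℝ} (hq : 0 < q) (s t k : ℕ) :
    mollFactor q (.pos s) t (.int 0) k = ((q ^ k)⁻¹ + 1) * qMono q s t k := by
  have e : (t : ℤ) * k + Q (.int 0) k = ((t * k : ℕ) : ℤ) - (k : ℤ) := by
    rw [Q_zero]; push_cast; ring
  have := (pow_pos hq k).ne'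
  rw [mollFactor, e, zpow_sub₀ hq.ne', zpow_natCast, zpow_natCast, qMono]
  simp only [SignedNat.sgn, SignedNat.abs]
  field_simp
  ring

lemma mollFactor_int_neg_one {q : ℝ} (hq : 0 < q) (s t k : ℕ) :
    mollFactor q (.bar s) t (.int (-1)) k = ((q ^ k)⁻¹ + 1) * qAltMono q s t k := by
  have e : (t : ℤ) * k + Q (.int (-1)) k = ((t * k : ℕ) : ℤ) - (k.choose 2 : ℤ) - (k : ℤ) := by
    rw [Q_neg_one]; push_cast; ring
  have := (pow_pos hq k).ne'
  have := (pow_pos hq (k.choose 2)).ne'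
  rw [mollFactor, e, zpow_sub₀ hq.ne', zpow_sub₀ hq.ne', zpow_natCast, zpow_natCast,
    zpow_natCast, qAltMono, qMono]
  simp only [SignedNat.sgn, SignedNat.abs]
  field_simp

/-- The two summands are the two outcomes of the entry 3: keep the index, or open a smaller one with
alternating signs. -/
lemma truncStar_key_suffix {q : ℝ} (hq : 0 < q) (c d n : ℕ) :
    truncStar q n (List.replicate c (.pos 2) ++ .pos 3 :: (List.replicate d (.pos 2) ++ [.pos 1])) =
      transform q n fun k => qMono q (2*c+2*d+4) (c+d+2) k + qAltMono q (2*c+2) (c+1) k *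
        truncMoll q (k - 1) ![.bar (2*d+2)] ![d+1] ![.int 1] := by
  rw [truncStar_replicate_two hq (truncStar_three_cons hq
    (truncStar_replicate_two hq (truncStar_one hq) d)) c n]
  refine transform_congr fun k _ => ?_
  have hz : ∀ j, q ^ (d * j) / qInt q j ^ (2 * d) * (q ^ j / qInt q j) / qInt q j =
      qMono q (2*d+2) (d+1) j := by
    intro j
    rw [qMono, add_mul, one_mul, pow_add, pow_add, div_mul_div_comm, div_div]
    ring
  have hc : ∀ X, q ^ (c * k) / qInt q k ^ (2 * c) * (q ^ k / qInt q k ^ 2 * X) =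
      qMono q (2*c+2) (c+1) k * X := by
    intro X
    rw [qMono, add_mul, one_mul, pow_add, pow_add, ← mul_assoc, div_mul_div_comm]
  have hsum : ∀ n, truncMoll q n ![.bar (2*d+2)] ![d+1] ![.int 1] = ∑ j ∈ Finset.Icc 1 n,
      (-1) ^ j * q ^ j.choose 2 * (1 + q ^ j) * qMono q (2*d+2) (d+1) j := by
    intro n
    rw [truncMoll_cons]
    simp only [truncMoll_zero, mul_one, mollFactor_int_one]
  simp only [hz, hc, hsum, qAltMono]
  have := qMono_mul q (2*c+2) (c+1) (2*d+2) (d+1) k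
  rw [show 2*c+2*d+4 = 2*c+2 + (2*d+2) by ring, show c+d+2 = c+1+(d+1) by ring]
  rw [← this]
  ring

lemma truncStar_replicate_one {q : ℝ} (hq : 0 < q) {l : List SignedNat} {α : ℕ → ℝ}
    (h : ∀ n, truncStar q n l = transform q n α) (a n : ℕ) :
    truncStar q n (List.replicate a (.pos 2) ++ .pos 1 :: l) =
      transform q n fun k => qMono q (2*a+1) (a+1) k *
        (α k + ∑ j ∈ Finset.Icc 1 (k - 1), ((q ^ j)⁻¹ + 1) * α j) := by
  rw [truncStar_replicate_two hq (truncStar_one_cons hq h) a n]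
  refine transform_congr fun k _ => ?_
  rw [qMono, add_mul, one_mul, pow_add, pow_add, ← mul_assoc, div_mul_div_comm, pow_one]

lemma truncStar_key_tail {q : ℝ} (hq : 0 < q) (b c d n : ℕ) :
    truncStar q n (List.replicate b (.pos 2) ++ .pos 1 :: (List.replicate c (.pos 2) ++
      .pos 3 :: (List.replicate d (.pos 2) ++ [.pos 1]))) =
      transform q n fun k => qMono q (2*b+2*c+2*d+5) (b+c+d+3) k
        + qAltMono q (2*b+2*c+3) (b+c+2) k *
          truncMoll q (k - 1) ![.bar (2*d+2)] ![d+1] ![.int 1]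
        + qMono q (2*b+1) (b+1) k * truncMoll q (k - 1) ![.pos (2*c+2*d+4)] ![c+d+2] ![.int 0]
        + qMono q (2*b+1) (b+1) k * truncMoll q (k - 1) ![.bar (2*c+2), .bar (2*d+2)]
            ![c+1, d+1] ![.int (-1), .int 1] := by
  rw [truncStar_replicate_one hq (truncStar_key_suffix hq c d) b n]
  refine transform_congr fun k _ => ?_
  rw [truncMoll_cons q _ (.pos (2*c+2*d+4)), truncMoll_cons q _ (.bar (2*c+2))]
  simp only [truncMoll_zero, mul_one, mollFactor_int_zero hq, mollFactor_int_neg_one hq,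
    mul_add, Finset.sum_add_distrib]
  rw [← mul_assoc, qMono_mul, qMono_mul_qAltMono]
  simp only [mul_assoc]
  rw [show 2*b+1+(2*c+2*d+4) = 2*b+2*c+2*d+5 by ring, show b+1+(c+d+2) = b+c+d+3 by ring,
    show 2*b+1+(2*c+2) = 2*b+2*c+3 by ring, show b+1+(c+1) = b+c+2 by ring]
  ring

lemma truncStar_keyString {q : ℝ} (hq : 0 < q) (a b c d n : ℕ) :
    truncStar q n (keyString a b c d) =
      kernelMoll q n ![.pos (2*a+2*b+2*c+2*d+6)] ![a+b+c+d+4] ![.int 2]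
      + kernelMoll q n ![.pos (2*a+1), .pos (2*b+2*c+2*d+5)] ![a+1, b+c+d+3] ![.int 2, .int 0]
      + kernelMoll q n ![.pos (2*a+2*b+2), .pos (2*c+2*d+4)] ![a+b+2, c+d+2] ![.int 2, .int 0]
      + kernelMoll q n ![.bar (2*a+2*b+2*c+4), .bar (2*d+2)] ![a+b+c+3, d+1] ![.int 1, .int 1]
      + kernelMoll q n ![.pos (2*a+1), .pos (2*b+1), .pos (2*c+2*d+4)]
          ![a+1, b+1, c+d+2] ![.int 2, .int 0, .int 0]
      + kernelMoll q n ![.pos (2*a+1), .bar (2*b+2*c+3), .bar (2*d+2)]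
          ![a+1, b+c+2, d+1] ![.int 2, .int (-1), .int 1]
      + kernelMoll q n ![.pos (2*a+2*b+2), .bar (2*c+2), .bar (2*d+2)]
          ![a+b+2, c+1, d+1] ![.int 2, .int (-1), .int 1]
      + kernelMoll q n ![.pos (2*a+1), .pos (2*b+1), .bar (2*c+2), .bar (2*d+2)]
          ![a+1, b+1, c+1, d+1] ![.int 2, .int 0, .int (-1), .int 1] := by
  have hkey : keyString a b c d = List.replicate a (.pos 2) ++ .pos 1 ::
      (List.replicate b (.pos 2) ++ .pos 1 :: (List.replicate c (.pos 2) ++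
      .pos 3 :: (List.replicate d (.pos 2) ++ [.pos 1]))) := by
    simp [keyString]
  rw [hkey, truncStar_replicate_one hq (truncStar_key_tail hq b c d) a n]
  simp only [kernelMoll_cons q n]
  simp only [← Finset.sum_add_distrib, transform]
  refine Finset.sum_congr rfl fun k _ => ?_
  rw [truncMoll_cons q _ (.pos (2*b+2*c+2*d+5)), truncMoll_cons q _ (.bar (2*b+2*c+3)),
    truncMoll_cons q _ (.pos (2*b+1)) _ _ ![.pos (2*c+2*d+4)],
    truncMoll_cons q _ (.pos (2*b+1)) _ _ ![.bar (2*c+2), .bar (2*d+2)]]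
  simp only [truncMoll_zero, mul_one, mollFactor_int_two q, mollFactor_int_one' hq]
  -- Exponents merge exactly in the terms where the first 1 opens no new index; `e2` serves two of
  -- these four terms.
  have e1 := qMono_mul q (2*a+1) (a+1) (2*b+2*c+2*d+5) (b+c+d+3) k
  have e2 := qMono_mul q (2*a+1) (a+1) (2*b+1) (b+1) k
  have e3 := qMono_mul_qAltMono q (2*a+1) (a+1) (2*b+2*c+3) (b+c+2) k
  rw [show 2*a+1+(2*b+2*c+2*d+5) = 2*a+2*b+2*c+2*d+6 by ring,
    show a+1+(b+c+d+3) = a+b+c+d+4 by ring] at e1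
  rw [show 2*a+1+(2*b+1) = 2*a+2*b+2 by ring, show a+1+(b+1) = a+b+2 by ring] at e2
  rw [show 2*a+1+(2*b+2*c+3) = 2*a+2*b+2*c+4 by ring,
    show a+1+(b+c+2) = a+b+c+3 by ring] at e3
  rw [← e1, ← e2, ← e3]
  simp only [mollFactor_int_zero hq, mollFactor_int_neg_one hq, mul_add, Finset.sum_add_distrib,
    mul_assoc]
  ring

/-- The identity for all `0 < q ≤ 1`, given that the series on the right converge. -/
lemma qStar_keyString {q : ℝ} (hq : 0 < q) (hq1 : q ≤ 1) (a b c d : ℕ)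
    (h1 : MollConverges q ![.pos (2*a+2*b+2*c+2*d+6)] ![a+b+c+d+4] ![.int 2])
    (h2 : MollConverges q ![.pos (2*a+1), .pos (2*b+2*c+2*d+5)] ![a+1, b+c+d+3]
      ![.int 2, .int 0])
    (h3 : MollConverges q ![.pos (2*a+2*b+2), .pos (2*c+2*d+4)] ![a+b+2, c+d+2]
      ![.int 2, .int 0])
    (h4 : MollConverges q ![.bar (2*a+2*b+2*c+4), .bar (2*d+2)] ![a+b+c+3, d+1]
      ![.int 1, .int 1])
    (h5 : MollConverges q ![.pos (2*a+1), .pos (2*b+1), .pos (2*c+2*d+4)]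
        ![a+1, b+1, c+d+2] ![.int 2, .int 0, .int 0])
    (h6 : MollConverges q ![.pos (2*a+1), .bar (2*b+2*c+3), .bar (2*d+2)]
        ![a+1, b+c+2, d+1] ![.int 2, .int (-1), .int 1])
    (h7 : MollConverges q ![.pos (2*a+2*b+2), .bar (2*c+2), .bar (2*d+2)]
        ![a+b+2, c+1, d+1] ![.int 2, .int (-1), .int 1])
    (h8 : MollConverges q ![.pos (2*a+1), .pos (2*b+1), .bar (2*c+2), .bar (2*d+2)]
        ![a+1, b+1, c+1, d+1] ![.int 2, .int 0, .int (-1), .int 1]) :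
    QStarConverges q (keyString a b c d).get ∧
    qStar q (keyString a b c d).get =
        moll q ![.pos (2*a+2*b+2*c+2*d+6)] ![a+b+c+d+4] ![.int 2]
        + moll q ![.pos (2*a+1), .pos (2*b+2*c+2*d+5)] ![a+1, b+c+d+3] ![.int 2, .int 0]
        + moll q ![.pos (2*a+2*b+2), .pos (2*c+2*d+4)] ![a+b+2, c+d+2] ![.int 2, .int 0]
        + moll q ![.bar (2*a+2*b+2*c+4), .bar (2*d+2)] ![a+b+c+3, d+1] ![.int 1, .int 1]
        + moll q ![.pos (2*a+1), .pos (2*b+1), .pos (2*c+2*d+4)]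
            ![a+1, b+1, c+d+2] ![.int 2, .int 0, .int 0]
        + moll q ![.pos (2*a+1), .bar (2*b+2*c+3), .bar (2*d+2)]
            ![a+1, b+c+2, d+1] ![.int 2, .int (-1), .int 1]
        + moll q ![.pos (2*a+2*b+2), .bar (2*c+2), .bar (2*d+2)]
            ![a+b+2, c+1, d+1] ![.int 2, .int (-1), .int 1]
        + moll q ![.pos (2*a+1), .pos (2*b+1), .bar (2*c+2), .bar (2*d+2)]
            ![a+1, b+1, c+1, d+1] ![.int 2, .int 0, .int (-1), .int 1] := by
  have key := hasSum_qTerm_of_tendsto hq (l := keyString a b c d) (L := _) ?_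
    ((((((((tendsto_kernelMoll hq hq1 h1).add (tendsto_kernelMoll hq hq1 h2)).add
      (tendsto_kernelMoll hq hq1 h3)).add (tendsto_kernelMoll hq hq1 h4)).add
      (tendsto_kernelMoll hq hq1 h5)).add (tendsto_kernelMoll hq hq1 h6)).add
      (tendsto_kernelMoll hq hq1 h7)).add (tendsto_kernelMoll hq hq1 h8) |>.congr fun n =>
        (truncStar_keyString hq a b c d n).symm)
  · exact ⟨key.summable, key.tsum_eq⟩
  · intro s hs
    simp only [keyString, List.mem_append, List.mem_replicate, List.mem_singleton] at hs
    rcases hs with ((((((⟨-, rfl⟩ | rfl) | ⟨-, rfl⟩) | rfl) | ⟨-, rfl⟩) | rfl) | ⟨-, rfl⟩) | rfl <;>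
      rfl

/-! ### Absolute convergence -/

lemma summable_prod_pi {g : ℕ → ℝ} (hg0 : ∀ n, 0 ≤ g n) (hg : Summable g) (m : ℕ) :
    Summable fun k : Fin m → ℕ => ∏ j, g (k j) := by
  induction m with
  | zero => exact Summable.of_finite
  | succ m ih =>
    rw [← (Fin.consEquiv fun _ : Fin (m + 1) => ℕ).summable_iff]
    refine (hg.mul_of_nonneg ih hg0 fun k => Finset.prod_nonneg fun j _ => hg0 _).congr fun p => ?_
    simp [Fin.prod_univ_succ, Fin.consEquiv]

lemma abs_sgn_pow (s : SignedNat) (k : ℕ) : |s.sgn ^ k| = 1 := by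
  cases s <;> simp [SignedNat.sgn]

lemma norm_eulerTerm {m : ℕ} (s : Fin m → SignedNat) (k : Fin m → ℕ) :
    ‖eulerTerm s k‖ = ∏ j, 1 / (k j : ℝ) ^ (s j).abs := by
  rw [eulerTerm, norm_prod]
  refine Finset.prod_congr rfl fun j _ => ?_
  rw [Real.norm_eq_abs, abs_div, abs_sgn_pow, abs_of_nonneg (by positivity)]

lemma eulerConverges_of_le {m : ℕ} {s : Fin m → SignedNat}
    (h : ∀ k : StrictTuple m, ∏ j, 1 / (k.1 j : ℝ) ^ (s j).abs ≤ ∏ j, 1 / (k.1 j : ℝ) ^ 2) :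
    EulerConverges s := by
  have hs : Summable fun k : Fin m → ℕ => ∏ j, 1 / (k j : ℝ) ^ 2 :=
    summable_prod_pi (g := fun n => 1 / (n : ℝ) ^ 2) (fun n => by positivity)
      (Real.summable_one_div_nat_pow.2 one_lt_two) m
  refine Summable.of_norm_bounded (hs.comp_injective Subtype.val_injective) fun k => ?_
  rw [norm_eulerTerm]
  exact h k

lemma one_div_pow_le {k s t : ℕ} (hk : 1 ≤ k) (h : t ≤ s) :
    1 / (k : ℝ) ^ s ≤ 1 / (k : ℝ) ^ t :=
  one_div_le_one_div_of_le (by positivity) (pow_le_pow_right₀ (by exact_mod_cast hk) h)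

lemma eulerConverges_of_two_le {m : ℕ} {s : Fin m → SignedNat} (h : ∀ j, 2 ≤ (s j).abs) :
    EulerConverges s :=
  eulerConverges_of_le fun k => Finset.prod_le_prod (fun _ _ => by positivity) fun j _ =>
    one_div_pow_le (k.2.2 j) (h j)

/-- Since $k_2<k_1$, one power of $k_1$ can be traded for one of $k_2$: $k_1^{-3}k_2^{-1}\le
k_1^{-2}k_2^{-2}$. -/
lemma eulerConverges_of_three_le {m : ℕ} {s₀ s₁ : SignedNat} {s : Fin m → SignedNat}
    (h₀ : 3 ≤ s₀.abs) (h₁ : 1 ≤ s₁.abs) (h : ∀ j, 2 ≤ (s j).abs) :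
    EulerConverges (Matrix.vecCons s₀ (Matrix.vecCons s₁ s)) := by
  refine eulerConverges_of_le fun k => ?_
  rw [Fin.prod_univ_succ, Fin.prod_univ_succ, Fin.prod_univ_succ, Fin.prod_univ_succ,
    ← mul_assoc, ← mul_assoc]
  have hk0 := k.2.2 0
  have hk1 := k.2.2 1
  have hlt : k.1 1 < k.1 0 := k.2.1 (by simp)
  refine mul_le_mul ?_ ?_ (Finset.prod_nonneg fun _ _ => by positivity) (by positivity)
  · simp only [Matrix.cons_val_zero, Fin.succ_zero_eq_one, Matrix.cons_val_one]
    calc 1 / (k.1 0 : ℝ) ^ s₀.abs * (1 / (k.1 1 : ℝ) ^ s₁.abs)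
        ≤ 1 / (k.1 0 : ℝ) ^ 3 * (1 / (k.1 1 : ℝ) ^ 1) :=
          mul_le_mul (one_div_pow_le hk0 h₀) (one_div_pow_le hk1 h₁) (by positivity)
            (by positivity)
      _ ≤ 1 / (k.1 0 : ℝ) ^ 2 * (1 / (k.1 1 : ℝ) ^ 2) := by
          have h0 : (0 : ℝ) < k.1 0 := by exact_mod_cast hk0
          have h1 : (0 : ℝ) < k.1 1 := by exact_mod_cast hk1
          have hle : (k.1 1 : ℝ) ≤ k.1 0 := by exact_mod_cast hlt.le
          rw [one_div_mul_one_div, one_div_mul_one_div]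
          refine one_div_le_one_div_of_le (by positivity) ?_
          nlinarith [mul_le_mul_of_nonneg_left hle
            (show (0 : ℝ) ≤ (k.1 0 : ℝ) ^ 2 * k.1 1 by positivity)]
  · refine Finset.prod_le_prod (fun _ _ => by positivity) fun j _ => ?_
    simp only [Matrix.cons_val_succ]
    exact one_div_pow_le (k.2.2 _) (h j)

lemma abs_mollFactor_le {q : ℝ} (hq : 0 < q) (hq1 : q < 1) (s : SignedNat) (t : ℕ)
    (r : IntTheta) {k : ℕ} (hk : 1 ≤ k) :
    |mollFactor q s t r k| ≤ 2 * q ^ ((t : ℤ) * (k : ℤ) + Q r k) := by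
  have h1 := one_le_pow₀ (n := s.abs) (one_le_qInt hq hk)
  have h2 : q ^ k ≤ 1 := pow_le_one₀ hq.le hq1.le
  have h3 : 0 < q ^ ((t : ℤ) * (k : ℤ) + Q r k) := zpow_pos hq _
  have h4 := pow_pos hq k
  rw [mollFactor, abs_div, abs_mul, abs_mul, abs_sgn_pow, abs_of_pos h3,
    abs_of_pos (by linarith), abs_of_pos (by linarith)]
  refine (div_le_self (by positivity) h1).trans ?_
  nlinarith

lemma prod_zpow_eq {ι : Type*} {x : ℝ} (hx : x ≠ 0) (u : Finset ι) (f : ι → ℤ) :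
    ∏ i ∈ u, x ^ f i = x ^ ∑ i ∈ u, f i := by
  classical
  induction u using Finset.induction_on with
  | empty => simp
  | insert i u hi ih => rw [Finset.prod_insert hi, Finset.sum_insert hi, ih, zpow_add₀ hx]

lemma mollConverges_of_le {q : ℝ} (hq : 0 < q) (hq1 : q < 1) {m : ℕ} {s : Fin m → SignedNat}
    {t : Fin m → ℕ} {r : Fin m → IntTheta}
    (h : ∀ k : StrictTuple m,
      ∑ j, (k.1 j : ℤ) ≤ 4 * ∑ j, ((t j : ℤ) * (k.1 j : ℤ) + Q (r j) (k.1 j))) :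
    MollConverges q s t r := by
  -- A fourth root suffices: depth is at most 4 in the applications, every index is at most $k_1$,
  -- and the total exponent of $q$ will be at least $k_1$.
  obtain ⟨ρ, hρ, hρq⟩ : ∃ ρ : ℝ, 0 < ρ ∧ ρ ^ 4 = q :=
    ⟨q ^ ((4 : ℕ) : ℝ)⁻¹, Real.rpow_pos_of_pos hq _, Real.rpow_inv_natCast_pow hq.le (by norm_num)⟩
  have hρ1 : ρ < 1 := by
    by_contra! hge
    have := one_le_pow₀ (n := 4) hge
    linarith
  have hs : Summable fun k : Fin m → ℕ => ∏ j, ρ ^ k j :=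
    summable_prod_pi (g := fun n => ρ ^ n) (fun n => by positivity)
      (summable_geometric_of_lt_one hρ.le hρ1) m
  refine Summable.of_norm_bounded
    ((hs.comp_injective Subtype.val_injective).mul_left (2 ^ m)) fun k => ?_
  calc ‖mollTerm q s t r k.1‖ = ∏ j, |mollFactor q (s j) (t j) (r j) (k.1 j)| := by
        rw [mollTerm, norm_prod]; rfl
    _ ≤ ∏ j, 2 * q ^ ((t j : ℤ) * (k.1 j : ℤ) + Q (r j) (k.1 j)) :=
        Finset.prod_le_prod (fun _ _ => abs_nonneg _) fun j _ =>
          abs_mollFactor_le hq hq1 _ _ _ (k.2.2 j)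
    _ = 2 ^ m * ρ ^ (4 * ∑ j, ((t j : ℤ) * (k.1 j : ℤ) + Q (r j) (k.1 j))) := by
        rw [Finset.prod_mul_distrib, Finset.prod_const, Finset.card_univ, Fintype.card_fin,
          zpow_mul, ← hρq]
        congr 1
        rw [prod_zpow_eq (pow_pos hρ 4).ne']
        norm_cast
    _ ≤ 2 ^ m * ρ ^ (∑ j, (k.1 j : ℤ)) :=
        mul_le_mul_of_nonneg_left (zpow_le_zpow_right_of_le_one₀ hρ hρ1.le (h k)) (by positivity)
    _ = 2 ^ m * ∏ j, ρ ^ k.1 j := by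
        rw [← Nat.cast_sum, zpow_natCast, Finset.prod_pow_eq_pow_sum]

/-- The surplus $\binom k2$ is kept to pay for the deficit $-\binom{k_j}2$ of a later entry with
$r=-1$. -/
lemma exponent_int_two_ge {t : ℕ} (ht : 1 ≤ t) (k : ℕ) :
    (k : ℤ) + k.choose 2 ≤ (t : ℤ) * k + Q (.int 2) k := by
  have : (k : ℤ) ≤ t * k := by exact_mod_cast Nat.le_mul_of_pos_left k ht
  rw [Q_two]; omega

lemma exponent_int_one_ge {t : ℕ} (ht : 1 ≤ t) (k : ℕ) :
    (k : ℤ) ≤ (t : ℤ) * k + Q (.int 1) k := by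
  have : (k : ℤ) ≤ t * k := by exact_mod_cast Nat.le_mul_of_pos_left k ht
  rw [Q_one]; omega

lemma exponent_int_zero_ge {t : ℕ} (ht : 1 ≤ t) (k : ℕ) :
    0 ≤ (t : ℤ) * k + Q (.int 0) k := by
  have : (k : ℤ) ≤ t * k := by exact_mod_cast Nat.le_mul_of_pos_left k ht
  rw [Q_zero]; omega

lemma exponent_int_neg_one_ge {t : ℕ} (ht : 1 ≤ t) (k : ℕ) :
    -(k.choose 2 : ℤ) ≤ (t : ℤ) * k + Q (.int (-1)) k := by
  have : (k : ℤ) ≤ t * k := by exact_mod_cast Nat.le_mul_of_pos_left k ht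
  rw [Q_neg_one]; omega

lemma mollConverges_two {q : ℝ} (hq : 0 < q) (hq1 : q < 1)
    (s : Fin 1 → SignedNat) {t : Fin 1 → ℕ} (ht : ∀ j, 1 ≤ t j) :
    MollConverges q s t ![.int 2] :=
  mollConverges_of_le hq hq1 fun k => by
    have e0 := exponent_int_two_ge (ht 0) (k.1 0)
    simp only [Fin.sum_univ_one, Matrix.cons_val_zero]
    omega

lemma mollConverges_two_zero {q : ℝ} (hq : 0 < q) (hq1 : q < 1)
    (s : Fin 2 → SignedNat) {t : Fin 2 → ℕ} (ht : ∀ j, 1 ≤ t j) :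
    MollConverges q s t ![.int 2, .int 0] :=
  mollConverges_of_le hq hq1 fun k => by
    have l1 : k.1 1 < k.1 0 := k.2.1 (by decide)
    have e0 := exponent_int_two_ge (ht 0) (k.1 0)
    have e1 := exponent_int_zero_ge (ht 1) (k.1 1)
    simp only [Fin.sum_univ_two, Matrix.cons_val_zero, Matrix.cons_val_one]
    omega

lemma mollConverges_one_one {q : ℝ} (hq : 0 < q) (hq1 : q < 1)
    (s : Fin 2 → SignedNat) {t : Fin 2 → ℕ} (ht : ∀ j, 1 ≤ t j) :
    MollConverges q s t ![.int 1, .int 1] :=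
  mollConverges_of_le hq hq1 fun k => by
    have l1 : k.1 1 < k.1 0 := k.2.1 (by decide)
    have e0 := exponent_int_one_ge (ht 0) (k.1 0)
    have e1 := exponent_int_one_ge (ht 1) (k.1 1)
    simp only [Fin.sum_univ_two, Matrix.cons_val_zero, Matrix.cons_val_one]
    omega

lemma mollConverges_two_zero_zero {q : ℝ} (hq : 0 < q) (hq1 : q < 1)
    (s : Fin 3 → SignedNat) {t : Fin 3 → ℕ} (ht : ∀ j, 1 ≤ t j) :
    MollConverges q s t ![.int 2, .int 0, .int 0] :=
  mollConverges_of_le hq hq1 fun k => by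
    have l1 : k.1 1 < k.1 0 := k.2.1 (by decide)
    have l2 : k.1 2 < k.1 1 := k.2.1 (by decide)
    have e0 := exponent_int_two_ge (ht 0) (k.1 0)
    have e1 := exponent_int_zero_ge (ht 1) (k.1 1)
    have e2 := exponent_int_zero_ge (ht 2) (k.1 2)
    simp only [Fin.sum_univ_three, Matrix.cons_val_zero, Matrix.cons_val_one, Matrix.cons_val]
    omega

lemma mollConverges_two_neg_one_one {q : ℝ} (hq : 0 < q) (hq1 : q < 1)
    (s : Fin 3 → SignedNat) {t : Fin 3 → ℕ} (ht : ∀ j, 1 ≤ t j) :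
    MollConverges q s t ![.int 2, .int (-1), .int 1] :=
  mollConverges_of_le hq hq1 fun k => by
    have l1 : k.1 1 < k.1 0 := k.2.1 (by decide)
    have l2 : k.1 2 < k.1 1 := k.2.1 (by decide)
    have e0 := exponent_int_two_ge (ht 0) (k.1 0)
    have e1 := exponent_int_neg_one_ge (ht 1) (k.1 1)
    have e2 := exponent_int_one_ge (ht 2) (k.1 2)
    have hc : (k.1 1).choose 2 ≤ (k.1 0).choose 2 := Nat.choose_le_choose 2 (by omega)
    simp only [Fin.sum_univ_three, Matrix.cons_val_zero, Matrix.cons_val_one, Matrix.cons_val]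
    omega

lemma mollConverges_two_zero_neg_one_one {q : ℝ} (hq : 0 < q) (hq1 : q < 1)
    (s : Fin 4 → SignedNat) {t : Fin 4 → ℕ} (ht : ∀ j, 1 ≤ t j) :
    MollConverges q s t ![.int 2, .int 0, .int (-1), .int 1] :=
  mollConverges_of_le hq hq1 fun k => by
    have l1 : k.1 1 < k.1 0 := k.2.1 (by decide)
    have l2 : k.1 2 < k.1 1 := k.2.1 (by decide)
    have l3 : k.1 3 < k.1 2 := k.2.1 (by decide)
    have e0 := exponent_int_two_ge (ht 0) (k.1 0)
    have e1 := exponent_int_zero_ge (ht 1) (k.1 1)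
    have e2 := exponent_int_neg_one_ge (ht 2) (k.1 2)
    have e3 := exponent_int_one_ge (ht 3) (k.1 3)
    have hc : (k.1 2).choose 2 ≤ (k.1 0).choose 2 := Nat.choose_le_choose 2 (by omega)
    simp only [Fin.sum_univ_four, Matrix.cons_val_zero, Matrix.cons_val_one, Matrix.cons_val]
    omega

/-! ### The classical specialization -/

lemma qTerm_one {m : ℕ} (s : Fin m → SignedNat) (k : Fin m → ℕ) :
    qTerm 1 s k = eulerTerm s k := by
  simp [qTerm, eulerTerm, qInt_one]

lemma mollTerm_one {m : ℕ} (s : Fin m → SignedNat) (t : Fin m → ℕ) (r : Fin m → IntTheta)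
    (k : Fin m → ℕ) : mollTerm 1 s t r k = 2 ^ m * eulerTerm s k := by
  have h2 : (2 : ℝ) ^ m = ∏ _j : Fin m, (2 : ℝ) := by simp
  rw [mollTerm, eulerTerm, h2, ← Finset.prod_mul_distrib]
  refine Finset.prod_congr rfl fun j _ => ?_
  rw [qInt_one, one_zpow, one_pow]
  ring

lemma moll_one {m : ℕ} (s : Fin m → SignedNat) (t : Fin m → ℕ) (r : Fin m → IntTheta) :
    moll 1 s t r = 2 ^ m * euler s := by
  simp only [moll, euler, mollTerm_one, tsum_mul_left]

lemma EulerConverges.mollConverges_one {m : ℕ} {s : Fin m → SignedNat} (h : EulerConverges s)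
    (t : Fin m → ℕ) (r : Fin m → IntTheta) : MollConverges 1 s t r := by
  simp only [MollConverges, mollTerm_one]
  exact h.mul_left _

end QMZV

theorem mainTheorem10 (a b c d : ℕ) :
    -- the classical identity, for `a ≥ 1`
    (1 ≤ a →
      EulerStarConverges (keyString a b c d).get ∧
      EulerConverges ![.pos (2*a+2*b+2*c+2*d+6)] ∧
      EulerConverges ![.pos (2*a+1), .pos (2*b+2*c+2*d+5)] ∧
      EulerConverges ![.pos (2*a+2*b+2), .pos (2*c+2*d+4)] ∧
      EulerConverges ![.bar (2*a+2*b+2*c+4), .bar (2*d+2)] ∧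
      EulerConverges ![.pos (2*a+1), .pos (2*b+1), .pos (2*c+2*d+4)] ∧
      EulerConverges ![.pos (2*a+1), .bar (2*b+2*c+3), .bar (2*d+2)] ∧
      EulerConverges ![.pos (2*a+2*b+2), .bar (2*c+2), .bar (2*d+2)] ∧
      EulerConverges ![.pos (2*a+1), .pos (2*b+1), .bar (2*c+2), .bar (2*d+2)] ∧
      eulerStar (keyString a b c d).get =
        2 * euler ![.pos (2*a+2*b+2*c+2*d+6)]
        + 4 * euler ![.pos (2*a+1), .pos (2*b+2*c+2*d+5)]
        + 4 * euler ![.pos (2*a+2*b+2), .pos (2*c+2*d+4)]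
        + 4 * euler ![.bar (2*a+2*b+2*c+4), .bar (2*d+2)]
        + 8 * euler ![.pos (2*a+1), .pos (2*b+1), .pos (2*c+2*d+4)]
        + 8 * euler ![.pos (2*a+1), .bar (2*b+2*c+3), .bar (2*d+2)]
        + 8 * euler ![.pos (2*a+2*b+2), .bar (2*c+2), .bar (2*d+2)]
        + 16 * euler ![.pos (2*a+1), .pos (2*b+1), .bar (2*c+2), .bar (2*d+2)]) ∧
    -- the `q`-analog, for all `a ≥ 0`
    (∀ q : ℝ, 0 < q → q < 1 →
      QStarConverges q (keyString a b c d).get ∧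
      MollConverges q ![.pos (2*a+2*b+2*c+2*d+6)] ![a+b+c+d+4] ![.int 2] ∧
      MollConverges q ![.pos (2*a+1), .pos (2*b+2*c+2*d+5)] ![a+1, b+c+d+3] ![.int 2, .int 0] ∧
      MollConverges q ![.pos (2*a+2*b+2), .pos (2*c+2*d+4)] ![a+b+2, c+d+2] ![.int 2, .int 0] ∧
      MollConverges q ![.bar (2*a+2*b+2*c+4), .bar (2*d+2)] ![a+b+c+3, d+1] ![.int 1, .int 1] ∧
      MollConverges q ![.pos (2*a+1), .pos (2*b+1), .pos (2*c+2*d+4)]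
        ![a+1, b+1, c+d+2] ![.int 2, .int 0, .int 0] ∧
      MollConverges q ![.pos (2*a+1), .bar (2*b+2*c+3), .bar (2*d+2)]
        ![a+1, b+c+2, d+1] ![.int 2, .int (-1), .int 1] ∧
      MollConverges q ![.pos (2*a+2*b+2), .bar (2*c+2), .bar (2*d+2)]
        ![a+b+2, c+1, d+1] ![.int 2, .int (-1), .int 1] ∧
      MollConverges q ![.pos (2*a+1), .pos (2*b+1), .bar (2*c+2), .bar (2*d+2)]
        ![a+1, b+1, c+1, d+1] ![.int 2, .int 0, .int (-1), .int 1] ∧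
      qStar q (keyString a b c d).get =
        moll q ![.pos (2*a+2*b+2*c+2*d+6)] ![a+b+c+d+4] ![.int 2]
        + moll q ![.pos (2*a+1), .pos (2*b+2*c+2*d+5)] ![a+1, b+c+d+3] ![.int 2, .int 0]
        + moll q ![.pos (2*a+2*b+2), .pos (2*c+2*d+4)] ![a+b+2, c+d+2] ![.int 2, .int 0]
        + moll q ![.bar (2*a+2*b+2*c+4), .bar (2*d+2)] ![a+b+c+3, d+1] ![.int 1, .int 1]
        + moll q ![.pos (2*a+1), .pos (2*b+1), .pos (2*c+2*d+4)]
            ![a+1, b+1, c+d+2] ![.int 2, .int 0, .int 0]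
        + moll q ![.pos (2*a+1), .bar (2*b+2*c+3), .bar (2*d+2)]
            ![a+1, b+c+2, d+1] ![.int 2, .int (-1), .int 1]
        + moll q ![.pos (2*a+2*b+2), .bar (2*c+2), .bar (2*d+2)]
            ![a+b+2, c+1, d+1] ![.int 2, .int (-1), .int 1]
        + moll q ![.pos (2*a+1), .pos (2*b+1), .bar (2*c+2), .bar (2*d+2)]
            ![a+1, b+1, c+1, d+1] ![.int 2, .int 0, .int (-1), .int 1]) := by
  constructor
  · intro ha
    have h1 : EulerConverges ![.pos (2*a+2*b+2*c+2*d+6)] :=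
      eulerConverges_of_two_le (by simp [SignedNat.abs])
    have h2 : EulerConverges ![.pos (2*a+1), .pos (2*b+2*c+2*d+5)] :=
      -- Here $a\ge1$ enters: it gives $2a+1\ge3$.
      eulerConverges_of_three_le (by simp [SignedNat.abs]; omega) (by simp [SignedNat.abs])
        (by simp)
    have h3 : EulerConverges ![.pos (2*a+2*b+2), .pos (2*c+2*d+4)] :=
      eulerConverges_of_two_le (by simp [Fin.forall_fin_succ, SignedNat.abs])
    have h4 : EulerConverges ![.bar (2*a+2*b+2*c+4), .bar (2*d+2)] :=
      eulerConverges_of_two_le (by simp [Fin.forall_fin_succ, SignedNat.abs])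
    have h5 : EulerConverges ![.pos (2*a+1), .pos (2*b+1), .pos (2*c+2*d+4)] :=
      eulerConverges_of_three_le (by simp [SignedNat.abs]; omega) (by simp [SignedNat.abs])
        (by simp [SignedNat.abs])
    have h6 : EulerConverges ![.pos (2*a+1), .bar (2*b+2*c+3), .bar (2*d+2)] :=
      eulerConverges_of_three_le (by simp [SignedNat.abs]; omega) (by simp [SignedNat.abs])
        (by simp [SignedNat.abs])
    have h7 : EulerConverges ![.pos (2*a+2*b+2), .bar (2*c+2), .bar (2*d+2)] :=
      eulerConverges_of_two_le (by simp [Fin.forall_fin_succ, SignedNat.abs])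
    have h8 : EulerConverges ![.pos (2*a+1), .pos (2*b+1), .bar (2*c+2), .bar (2*d+2)] :=
      eulerConverges_of_three_le (by simp [SignedNat.abs]; omega) (by simp [SignedNat.abs])
        (by simp [Fin.forall_fin_succ, SignedNat.abs])
    -- The identity is taken directly at $q=1$; no limit $q\to1$ is needed.
    obtain ⟨hs, he⟩ := qStar_keyString one_pos le_rfl a b c d (h1.mollConverges_one _ _)
      (h2.mollConverges_one _ _) (h3.mollConverges_one _ _) (h4.mollConverges_one _ _)
      (h5.mollConverges_one _ _) (h6.mollConverges_one _ _) (h7.mollConverges_one _ _)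
      (h8.mollConverges_one _ _)
    simp only [QStarConverges, qStar, qTerm_one, moll_one] at hs he
    refine ⟨hs, h1, h2, h3, h4, h5, h6, h7, h8, ?_⟩
    rw [eulerStar, he]
    norm_num
  · intro q hq hq1
    have h1 : MollConverges q ![.pos (2*a+2*b+2*c+2*d+6)]
        ![a+b+c+d+4] ![.int 2] :=
      mollConverges_two hq hq1 _ (by simp)
    have h2 : MollConverges q ![.pos (2*a+1), .pos (2*b+2*c+2*d+5)]
        ![a+1, b+c+d+3] ![.int 2, .int 0] :=
      mollConverges_two_zero hq hq1 _ (by simp [Fin.forall_fin_succ])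
    have h3 : MollConverges q ![.pos (2*a+2*b+2), .pos (2*c+2*d+4)]
        ![a+b+2, c+d+2] ![.int 2, .int 0] :=
      mollConverges_two_zero hq hq1 _ (by simp [Fin.forall_fin_succ])
    have h4 : MollConverges q ![.bar (2*a+2*b+2*c+4), .bar (2*d+2)]
        ![a+b+c+3, d+1] ![.int 1, .int 1] :=
      mollConverges_one_one hq hq1 _ (by simp [Fin.forall_fin_succ])
    have h5 : MollConverges q ![.pos (2*a+1), .pos (2*b+1), .pos (2*c+2*d+4)]
        ![a+1, b+1, c+d+2] ![.int 2, .int 0, .int 0] :=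
      mollConverges_two_zero_zero hq hq1 _ (by simp [Fin.forall_fin_succ])
    have h6 : MollConverges q ![.pos (2*a+1), .bar (2*b+2*c+3), .bar (2*d+2)]
        ![a+1, b+c+2, d+1] ![.int 2, .int (-1), .int 1] :=
      mollConverges_two_neg_one_one hq hq1 _ (by simp [Fin.forall_fin_succ])
    have h7 : MollConverges q ![.pos (2*a+2*b+2), .bar (2*c+2), .bar (2*d+2)]
        ![a+b+2, c+1, d+1] ![.int 2, .int (-1), .int 1] :=
      mollConverges_two_neg_one_one hq hq1 _ (by simp [Fin.forall_fin_succ])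
    have h8 : MollConverges q ![.pos (2*a+1), .pos (2*b+1), .bar (2*c+2), .bar (2*d+2)]
        ![a+1, b+1, c+1, d+1] ![.int 2, .int 0, .int (-1), .int 1] :=
      mollConverges_two_zero_neg_one_one hq hq1 _ (by simp [Fin.forall_fin_succ])
    obtain ⟨hs, he⟩ := qStar_keyString hq hq1.le a b c d h1 h2 h3 h4 h5 h6 h7 h8
    exact ⟨hs, h1, h2, h3, h4, h5, h6, h7, h8, he⟩
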